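/- Let $n\ge 1$ be an integer. Let $A(n)=(a_{kl})_{k,l\ge 1}$ be the infinite $\{0,1\}$-matrix constructed greedily row by row, each row from left to right, by the rule: $a_{kl}=0$ if $\sum_{j<l}a_{kj}\ge n+1$, or $\sum_{i<k}a_{il}\ge n+1$, or there are $1\le i<k$ and $1\le j<l$ with $a_{ij}=a_{il}=a_{kj}=1$; otherwise $a_{kl}=1$. Let $p$ be the least integer $p\ge1$ for which there is $c\ge 0$ with $a_{i+p,j+p}=a_{ij}$ for all $i>c$ and all $j\ge1$; for this $p$, let $pp$ be the least $c\ge 0$ with this property; and let $b=\max\{|j-i| : i,j\ge1,\ a_{ij}=1,\ i>pp\}$. Then $p$, $pp$ and $b$ are well defined (the two minima and the maximum exist), and the following holds. Let $m\ge1$ be an integer such that $r:=\lfloor pm/2\rfloor>b$, put $\overline p=pm$, and let $v\ge pp+\overline p$ be an integer. Let $B=(b_{ij})_{1\le i,j\le\overline p}$ be the $\overline p\times\overline p$ matrix with $$b_{ij}=\begin{cases}a_{v+i,\,v+j}&\text{if } i-r\le j\le i+r,\\ a_{v+i,\,v+j-\overline p}&\text{if } j>i+r,\\ a_{v+i,\,v+j+\overline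 p}&\text{if } j<i-r.\end{cases}$$ Then every row of $B$ contains exactly $n+1$ ones. -/

import Mathlib

/-- The matrix `A(n) = (a_{kl})` produced by the greedy algorithm. Rows and columns are numbered
from `1`; the cells with a zero index do not belong to the matrix and carry the value `0`, so they
do not influence the sums and the rectangle test below. Rows are filled one after the other, each
from left to right: `a_{kl} = 1` exactly when at most `n` ones stand to the left of the cell in its
row, at most `n` ones stand above it in its column, and there is no pair `(i, j)` with
`i < k`, `j < l` and `a_{ij} = a_{il} = a_{kj} = 1`. -/
def edgarMatrix (n k l : ℕ) : ℕ :=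
  if 1 ≤ k ∧ 1 ≤ l ∧
      ¬ (n + 1 ≤ ∑ j : Fin l, edgarMatrix n k j) ∧
      ¬ (n + 1 ≤ ∑ i : Fin k, edgarMatrix n i l) ∧
      ¬ (∃ i : Fin k, ∃ j : Fin l,
          edgarMatrix n i j = 1 ∧ edgarMatrix n i l = 1 ∧ edgarMatrix n k j = 1)
  then 1 else 0
termination_by (k, l)
decreasing_by
  all_goals
    first
      | exact Prod.Lex.left _ _ (Fin.isLt _)
      | exact Prod.Lex.right _ (Fin.isLt _)

/-- The recursion defining `A(n)`, for cells with positive indices, written with index sets of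
positive integers. -/
theorem edgarMatrix_eq_one_iff (n k l : ℕ) (hk : 1 ≤ k) (hl : 1 ≤ l) :
    edgarMatrix n k l = 1 ↔ ¬
      (n + 1 ≤ ∑ j ∈ Finset.Ico 1 l, edgarMatrix n k j ∨
          n + 1 ≤ ∑ i ∈ Finset.Ico 1 k, edgarMatrix n i l ∨
          (∃ i j : ℕ, 1 ≤ i ∧ i < k ∧ 1 ≤ j ∧ j < l ∧
            edgarMatrix n i j = 1 ∧ edgarMatrix n i l = 1 ∧ edgarMatrix n k j = 1)) := by
  have z1 : ∀ x, edgarMatrix n 0 x = 0 := by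
    intro x; rw [edgarMatrix]; simp
  have z2 : ∀ x, edgarMatrix n x 0 = 0 := by
    intro x; rw [edgarMatrix]; simp
  have s1 : ∑ j : Fin l, edgarMatrix n k j = ∑ j ∈ Finset.Ico 1 l, edgarMatrix n k j := by
    rw [Fin.sum_univ_eq_sum_range (fun j => edgarMatrix n k j) l, Finset.range_eq_Ico,
      Finset.sum_eq_sum_Ico_succ_bot (by omega), z2, zero_add]
  have s2 : ∑ i : Fin k, edgarMatrix n i l = ∑ i ∈ Finset.Ico 1 k, edgarMatrix n i l := by
    rw [Fin.sum_univ_eq_sum_range (fun i => edgarMatrix n i l) k, Finset.range_eq_Ico,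
      Finset.sum_eq_sum_Ico_succ_bot (by omega), z1, zero_add]
  have s3 : (∃ i : Fin k, ∃ j : Fin l,
        edgarMatrix n i j = 1 ∧ edgarMatrix n i l = 1 ∧ edgarMatrix n k j = 1) ↔
      (∃ i j : ℕ, 1 ≤ i ∧ i < k ∧ 1 ≤ j ∧ j < l ∧
        edgarMatrix n i j = 1 ∧ edgarMatrix n i l = 1 ∧ edgarMatrix n k j = 1) := by
    constructor
    · rintro ⟨i, j, h1, h2, h3⟩
      refine ⟨i, j, ?_, i.isLt, ?_, j.isLt, h1, h2, h3⟩
      · by_contra hi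
        have : (i : ℕ) = 0 := by omega
        rw [this, z1] at h1
        omega
      · by_contra hj
        have : (j : ℕ) = 0 := by omega
        rw [this, z2] at h1
        omega
    · rintro ⟨i, j, -, hi, -, hj, h⟩
      exact ⟨⟨i, hi⟩, ⟨j, hj⟩, h⟩
  rw [edgarMatrix, s1, s2, ← s3]
  split_ifs with h
  · simpa only [true_iff, not_or] using h.2.2
  · simp only [not_or]
    exact ⟨fun h0 => absurd h0 id, fun h0 => absurd ⟨hk, hl, h0⟩ h⟩

theorem edgarMatrix_eq_zero_or_one (n k l : ℕ) :
    edgarMatrix n k l = 0 ∨ edgarMatrix n k l = 1 := by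
  rw [edgarMatrix]
  split_ifs <;> simp

/-- `a_{i+p,j+p} = a_{ij}` for all `i > c` and all `j ≥ 1`. -/
def PeriodicBeyond (n p c : ℕ) : Prop :=
  ∀ i j : ℕ, c < i → 1 ≤ j → edgarMatrix n (i + p) (j + p) = edgarMatrix n i j

/-- The positive integers `p` such that `A(n)` repeats with period `p` below some row. -/
def periodSet (n : ℕ) : Set ℕ := {p | 1 ≤ p ∧ ∃ c : ℕ, PeriodicBeyond n p c}

/-- The period `p(n)`. -/
noncomputable def period (n : ℕ) : ℕ := sInf (periodSet n)

/-- The numbers `c` such that `A(n)` repeats with period `p(n)` below row `c`. -/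
def preperiodSet (n : ℕ) : Set ℕ := {c | PeriodicBeyond n (period n) c}

/-- The preperiod `pp(n)`. -/
noncomputable def preperiod (n : ℕ) : ℕ := sInf (preperiodSet n)

/-- The distances `|j - i|` from the diagonal of the ones `a_{ij} = 1` with `i > pp(n)`. -/
def diagDistSet (n : ℕ) : Set ℕ :=
  {d | ∃ i j : ℕ, 1 ≤ i ∧ 1 ≤ j ∧ edgarMatrix n i j = 1 ∧ preperiod n < i ∧
    d = ((j : ℤ) - (i : ℤ)).natAbs}

/-- The breadth `b(n)`. -/
noncomputable def breadth (n : ℕ) : ℕ := sSup (diagDistSet n)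

/-- The folded `q × q` matrix `B`, with rows and columns numbered `1, …, q` and `r = ⌊q / 2⌋`:
`b_{ij}` is `a_{v+i,v+j}` if `i - r ≤ j ≤ i + r`, it is `a_{v+i,v+j-q}` if `j > i + r`, and
`a_{v+i,v+j+q}` if `j < i - r`. It is only used for `q ≤ v`, so that all indices are positive and
the subtraction is exact. -/
def foldedMatrix (n q v : ℕ) : Matrix (Finset.Icc 1 q) (Finset.Icc 1 q) ℕ :=
  Matrix.of fun i j =>
    if (i : ℕ) ≤ j + q / 2 ∧ (j : ℕ) ≤ i + q / 2 then edgarMatrix n (v + i) (v + j)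
    else if (i : ℕ) + q / 2 < j then edgarMatrix n (v + i) (v + j - q)
    else edgarMatrix n (v + i) (v + j + q)

/-- The weight of a row: the number of its entries equal to `1`. -/
def rowWeight {ι κ : Type*} [Fintype κ] (M : Matrix ι κ ℕ) (i : ι) : ℕ :=
  (Finset.univ.filter fun j => M i j = 1).card

namespace EdgarMatrix

open Finset

variable {n : ℕ}

/-! All ones lie in a band around the diagonal. Upwards (`le_add_skipBound`), an incomplete row
skips boundedly many columns with room. Downwards (`row_le_of_eq_one`), every row puts a one into
the first column with room, so no column stays incomplete for long. Inside the band the greedy rule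
is local, and finitely many window patterns force a repetition (`periodSet_nonempty`); hence `p`,
`pp` and `b` exist. A row of `B` is row `v + i` of `A` with columns reduced modulo `q`. As `b < q /
2`, the ones of that row fit in one residue system, so none is lost or counted twice. -/

theorem zero_left (l : ℕ) : edgarMatrix n 0 l = 0 := by
  rw [edgarMatrix]; simp

theorem zero_right (k : ℕ) : edgarMatrix n k 0 = 0 := by
  rw [edgarMatrix]; simp

theorem eq_zero_of_ne_one {k l : ℕ} (h : edgarMatrix n k l ≠ 1) : edgarMatrix n k l = 0 :=
  (edgarMatrix_eq_zero_or_one n k l).resolve_right h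

theorem pos_left {k l : ℕ} (h : edgarMatrix n k l = 1) : 1 ≤ k := by
  by_contra hk
  rw [show k = 0 by omega, zero_left] at h
  omega

theorem pos_right {k l : ℕ} (h : edgarMatrix n k l = 1) : 1 ≤ l := by
  by_contra hl
  rw [show l = 0 by omega, zero_right] at h
  omega

/-- The number of ones of row `k` in the columns below `l`. -/
def rowSum (n k l : ℕ) : ℕ := ∑ j ∈ range l, edgarMatrix n k j

/-- The number of ones of column `l` in the rows below `k`. -/
def colSum (n k l : ℕ) : ℕ := ∑ i ∈ range k, edgarMatrix n i l

theorem rowSum_eq_Ico (k l : ℕ) : rowSum n k l = ∑ j ∈ Ico 1 l, edgarMatrix n k j := by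
  rcases Nat.eq_zero_or_pos l with rfl | h
  · simp [rowSum]
  · rw [rowSum, range_eq_Ico, sum_eq_sum_Ico_succ_bot h, zero_right, zero_add]

theorem colSum_eq_Ico (k l : ℕ) : colSum n k l = ∑ i ∈ Ico 1 k, edgarMatrix n i l := by
  rcases Nat.eq_zero_or_pos k with rfl | h
  · simp [colSum]
  · rw [colSum, range_eq_Ico, sum_eq_sum_Ico_succ_bot h, zero_left, zero_add]

theorem eq_one_iff {k l : ℕ} (hk : 1 ≤ k) (hl : 1 ≤ l) :
    edgarMatrix n k l = 1 ↔ rowSum n k l ≤ n ∧ colSum n k l ≤ n ∧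
      ∀ i j, i < k → j < l → edgarMatrix n i j = 1 → edgarMatrix n i l = 1 →
        edgarMatrix n k j ≠ 1 := by
  rw [edgarMatrix_eq_one_iff n k l hk hl, ← rowSum_eq_Ico, ← colSum_eq_Ico]
  push Not
  rw [Nat.lt_succ_iff, Nat.lt_succ_iff]
  refine and_congr_right fun _ => and_congr_right fun _ => ?_
  constructor
  · intro h i j hi hj h1 h2 h3
    exact h i j (pos_left h1) hi (pos_right h1) hj h1 h2 h3
  · intro h i j _ hi _ hj h1 h2 h3
    exact h i j hi hj h1 h2 h3

theorem rowSum_le_of_eq_one {k l : ℕ} (h : edgarMatrix n k l = 1) : rowSum n k l ≤ n :=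
  ((eq_one_iff (pos_left h) (pos_right h)).1 h).1

theorem colSum_le_of_eq_one {k l : ℕ} (h : edgarMatrix n k l = 1) : colSum n k l ≤ n :=
  ((eq_one_iff (pos_left h) (pos_right h)).1 h).2.1

theorem rowSum_le (k l : ℕ) : rowSum n k l ≤ n + 1 := by
  induction l with
  | zero => simp [rowSum]
  | succ l ih =>
    rw [rowSum, sum_range_succ, ← rowSum]
    by_cases h : edgarMatrix n k l = 1
    · have := rowSum_le_of_eq_one h
      omega
    · rw [eq_zero_of_ne_one h]
      omega

theorem colSum_le (k l : ℕ) : colSum n k l ≤ n + 1 := by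
  induction k with
  | zero => simp [colSum]
  | succ k ih =>
    rw [colSum, sum_range_succ, ← colSum]
    by_cases h : edgarMatrix n k l = 1
    · have := colSum_le_of_eq_one h
      omega
    · rw [eq_zero_of_ne_one h]
      omega

theorem colSum_succ (k l : ℕ) : colSum n (k + 1) l = colSum n k l + edgarMatrix n k l := by
  rw [colSum, sum_range_succ, ← colSum]

theorem colSum_mono {k k' : ℕ} (h : k ≤ k') (l : ℕ) : colSum n k l ≤ colSum n k' l :=
  sum_le_sum_of_subset (range_subset_range.2 h)

theorem card_filter_row (k l : ℕ) :
    #{j ∈ range l | edgarMatrix n k j = 1} = rowSum n k l := by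
  rw [card_filter, rowSum]
  refine sum_congr rfl fun j _ => ?_
  rcases edgarMatrix_eq_zero_or_one n k j with h | h <;> simp [h]

theorem card_filter_col (k l : ℕ) :
    #{i ∈ range k | edgarMatrix n i l = 1} = colSum n k l := by
  rw [card_filter, colSum]
  refine sum_congr rfl fun i _ => ?_
  rcases edgarMatrix_eq_zero_or_one n i l with h | h <;> simp [h]

/-! ### Ones above the diagonal -/

/-- The columns `1 ≤ j < l` with at most `n` ones in the rows below `k`. -/
def openCols (n k l : ℕ) : Finset ℕ := {j ∈ Ico 1 l | colSum n k j ≤ n}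

theorem mem_openCols {k l j : ℕ} :
    j ∈ openCols n k l ↔ (1 ≤ j ∧ j < l) ∧ colSum n k j ≤ n := by
  simp [openCols]

theorem openCols_subset {k k' l l' : ℕ} (hk : k ≤ k') (hl : l ≤ l') :
    openCols n k' l ⊆ openCols n k l' := by
  intro j hj
  rw [mem_openCols] at hj ⊢
  exact ⟨⟨hj.1.1, hj.1.2.trans_le hl⟩, (colSum_mono hk j).trans hj.2⟩

/-- A bound for the number of columns that a row can skip before it is complete. -/
def skipBound (n : ℕ) : ℕ := n + n * ((n + 1) * (n + 1))

/-- While a row is incomplete, a column with room is skipped only because of a rectangle, and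
the rectangles block boundedly many columns. -/
theorem card_openCols_le {k l : ℕ} (hk : 1 ≤ k) (h : rowSum n k l ≤ n) :
    #(openCols n k l) ≤ skipBound n := by
  set R : Finset ℕ := {j ∈ range l | edgarMatrix n k j = 1} with hR
  have hRc : #R ≤ n := (card_filter_row k l).trans_le h
  -- A skipped open column `j` closes a rectangle: row `k` has a one in some `j'`, and some row `i`
  -- has ones in `j'` and `j`. This leaves at most `n`, `n + 1` and `n + 1` choices for `j'`, `i`
  -- and `j`.
  have hsub : openCols n k l ⊆ R ∪ R.biUnion fun j' =>
      ({i ∈ range k | edgarMatrix n i j' = 1} : Finset ℕ).biUnion fun i =>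
        {j ∈ range l | edgarMatrix n i j = 1} := by
    intro j hj
    rw [mem_openCols] at hj
    obtain ⟨⟨hj1, hjl⟩, hc⟩ := hj
    by_cases hkj : edgarMatrix n k j = 1
    · exact mem_union_left _ (by simp [hR, hjl, hkj])
    · have hrow : rowSum n k j ≤ n :=
        (sum_le_sum_of_subset (range_subset_range.2 hjl.le)).trans h
      have := mt (eq_one_iff hk hj1).2 hkj
      push Not at this
      obtain ⟨i, j', hi, hj', h1, h2, h3⟩ := this hrow hc
      refine mem_union_right _ (mem_biUnion.2 ⟨j', ?_, mem_biUnion.2 ⟨i, ?_, ?_⟩⟩)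
      · simp [hR, h3, hj'.trans hjl]
      · simp [hi, h1]
      · simp [hjl, h2]
  refine (card_le_card hsub).trans ((card_union_le _ _).trans (add_le_add hRc ?_))
  refine (card_biUnion_le_card_mul _ _ ((n + 1) * (n + 1)) fun j' _ => ?_).trans
    (Nat.mul_le_mul_right _ hRc)
  refine (card_biUnion_le_card_mul _ _ (n + 1) fun i _ => ?_).trans
    (Nat.mul_le_mul_right _ ?_)
  · rw [card_filter_row]
    exact rowSum_le _ _
  · rw [card_filter_col]
    exact colSum_le _ _

theorem sum_rowSum_eq_sum_colSum (k l : ℕ) :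
    ∑ i ∈ Ico 1 k, rowSum n i l = ∑ j ∈ Ico 1 l, colSum n k j := by
  simp only [rowSum_eq_Ico, colSum_eq_Ico]
  exact sum_comm

/-- Full columns carry `n + 1` ones each, the `k - 1` earlier rows at most `n + 1` each, so at most
`k - 1` columns are full. -/
theorem le_add_skipBound {k l : ℕ} (hk : 1 ≤ k) (h : rowSum n k l ≤ n) :
    l ≤ k + skipBound n := by
  have h1 := card_openCols_le hk h
  have h2 : #(openCols n k l) + #{j ∈ Ico 1 l | ¬ colSum n k j ≤ n} = l - 1 := by
    rw [openCols, card_filter_add_card_filter_not, Nat.card_Ico]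
  have h3 : #{j ∈ Ico 1 l | ¬ colSum n k j ≤ n} * (n + 1) ≤ (k - 1) * (n + 1) := by
    calc #{j ∈ Ico 1 l | ¬ colSum n k j ≤ n} * (n + 1)
        ≤ ∑ j ∈ Ico 1 l with ¬ colSum n k j ≤ n, colSum n k j := by
          rw [← smul_eq_mul]
          refine card_nsmul_le_sum _ _ _ fun j hj => ?_
          have := (mem_filter.1 hj).2
          omega
      _ ≤ ∑ j ∈ Ico 1 l, colSum n k j := sum_le_sum_of_subset (filter_subset _ _)
      _ = ∑ i ∈ Ico 1 k, rowSum n i l := (sum_rowSum_eq_sum_colSum k l).symm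
      _ ≤ #(Ico 1 k) • (n + 1) := sum_le_card_nsmul _ _ _ fun i _ => rowSum_le i l
      _ = (k - 1) * (n + 1) := by simp
  have h4 := Nat.le_of_mul_le_mul_right h3 (Nat.succ_pos n)
  omega

theorem rowSum_eq {k l : ℕ} (hk : 1 ≤ k) (hl : k + skipBound n < l) :
    rowSum n k l = n + 1 := by
  have h1 := rowSum_le (n := n) k l
  by_contra h
  have := le_add_skipBound hk (show rowSum n k l ≤ n by omega)
  omega

theorem col_le_of_eq_one {k l : ℕ} (h : edgarMatrix n k l = 1) : l ≤ k + skipBound n :=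
  le_add_skipBound (pos_left h) (rowSum_le_of_eq_one h)

/-! ### Ones below the diagonal -/

/-- The first column with room receives a one. -/
theorem exists_eq_one_of_open {k l : ℕ} (hk : 1 ≤ k) (hl : 1 ≤ l) (h : colSum n k l ≤ n) :
    ∃ j, 1 ≤ j ∧ j ≤ l ∧ edgarMatrix n k j = 1 := by
  have hex : ∃ j, 1 ≤ j ∧ colSum n k j ≤ n := ⟨l, hl, h⟩
  classical
  obtain ⟨h1, h2⟩ := Nat.find_spec hex
  have hz : ∀ j < Nat.find hex, edgarMatrix n k j ≠ 1 := fun j hj hkj =>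
    Nat.find_min hex hj ⟨pos_right hkj, colSum_le_of_eq_one hkj⟩
  refine ⟨Nat.find hex, h1, Nat.find_min' hex ⟨hl, h⟩, (eq_one_iff hk h1).2 ⟨?_, h2, ?_⟩⟩
  · rw [rowSum, sum_eq_zero fun j hj => eq_zero_of_ne_one (hz j (mem_range.1 hj))]
    exact Nat.zero_le n
  · exact fun i j _ hj _ _ => hz j hj

/-- The number of ones missing in the columns `1, …, l` before row `k`. -/
def deficit (n k l : ℕ) : ℕ := ∑ j ∈ Ico 1 (l + 1), (n + 1 - colSum n k j)

theorem deficit_succ_lt {k l : ℕ} (hk : 1 ≤ k) (hl : 1 ≤ l) (h : colSum n k l ≤ n) :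
    deficit n (k + 1) l < deficit n k l := by
  obtain ⟨j, hj1, hjl, hj⟩ := exists_eq_one_of_open hk hl h
  refine sum_lt_sum (fun i _ => ?_) ⟨j, by simp; omega, ?_⟩
  · rw [colSum_succ]
    omega
  · rw [colSum_succ, hj]
    have := colSum_le_of_eq_one hj
    omega

theorem deficit_add_le {k l t : ℕ} (hk : 1 ≤ k) (hl : 1 ≤ l) (h : colSum n (k + t) l ≤ n) :
    deficit n (k + t) l + t ≤ deficit n k l := by
  induction t with
  | zero => simp
  | succ t ih =>
    have h' : colSum n (k + t) l ≤ n := (colSum_mono (by omega) l).trans h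
    have := ih h'
    have := deficit_succ_lt (by omega) hl h'
    rw [← add_assoc k t 1]
    omega

theorem deficit_le (k l : ℕ) : deficit n k l ≤ #(openCols n k (l + 1)) * (n + 1) := by
  have : deficit n k l = ∑ j ∈ openCols n k (l + 1), (n + 1 - colSum n k j) := by
    symm
    refine sum_subset (filter_subset _ _) fun j hj hj' => ?_
    rw [openCols, mem_filter, not_and] at hj'
    have := hj' hj
    omega
  rw [this]
  exact sum_le_card_nsmul _ _ _ fun j _ => Nat.sub_le _ _

theorem deficit_pos {k l : ℕ} (hl : 1 ≤ l) (h : colSum n k l ≤ n) : 0 < deficit n k l :=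
  (show 0 < n + 1 - colSum n k l by omega).trans_le
    (single_le_sum (f := fun j => n + 1 - colSum n k j) (fun _ _ => Nat.zero_le _)
      (by simp; omega))

/-- All ones lie within this distance from the diagonal. -/
def bandBound (n : ℕ) : ℕ := (skipBound n + 1) * (n + 1)

theorem skipBound_le_bandBound : skipBound n ≤ bandBound n := by
  unfold bandBound
  nlinarith [Nat.zero_le (skipBound n * n)]

/-- If column `l` still has room `bandBound n` rows after `k'`, the deficit at `k'` was so large
that more than `skipBound n + 1` columns up to `l` were open. Then no row before `k'` had reached
column `l`, and counting ones gives `k' ≤ l`. -/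
theorem row_le_of_eq_one {k l : ℕ} (h : edgarMatrix n k l = 1) : k ≤ l + bandBound n := by
  have hl := pos_right h
  by_contra! hk
  obtain ⟨k', rfl⟩ : ∃ k', k = k' + bandBound n := ⟨k - bandBound n, by omega⟩
  have hc := colSum_le_of_eq_one h
  have h1 := deficit_add_le (by omega) hl hc
  have h2 := deficit_pos hl hc
  have h3 : skipBound n + 1 < #(openCols n k' (l + 1)) :=
    lt_of_mul_lt_mul_right
      ((show bandBound n < deficit n k' l by omega).trans_le (deficit_le k' l))
      (Nat.zero_le (n + 1))
  have h4 : openCols n k' (l + 1) ⊆ insert l (openCols n k' l) := by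
    intro j hj
    rw [mem_openCols] at hj
    rw [mem_insert, mem_openCols]
    rcases eq_or_ne j l with e | e
    · exact Or.inl e
    · exact Or.inr ⟨⟨hj.1.1, by omega⟩, hj.2⟩
  have h5 := (card_le_card h4).trans (card_insert_le _ _)
  have h6 : ∀ i < k', ∀ j, edgarMatrix n i j = 1 → j < l := by
    intro i hi j hij
    by_contra! hlj
    have := card_openCols_le (pos_left hij) (rowSum_le_of_eq_one hij)
    have := card_le_card (openCols_subset (n := n) hi.le hlj)
    omega
  have h7 : ∀ i ∈ Ico 1 k', n + 1 ≤ rowSum n i l := by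
    intro i hi
    rw [mem_Ico] at hi
    -- The cutoff lies beyond both `l` and the end of row `i`.
    rw [← rowSum_eq (n := n) (l := max l (i + skipBound n + 1)) hi.1 (by omega)]
    refine (sum_subset (range_subset_range.2 (le_max_left _ _)) fun j _ hj => ?_).ge
    refine eq_zero_of_ne_one fun hij => hj (mem_range.2 (h6 i hi.2 j hij))
  have h8 : (k' - 1) * (n + 1) ≤ (l - 1) * (n + 1) := by
    calc (k' - 1) * (n + 1) = #(Ico 1 k') • (n + 1) := by simp
      _ ≤ ∑ i ∈ Ico 1 k', rowSum n i l := card_nsmul_le_sum _ _ _ h7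
      _ = ∑ j ∈ Ico 1 l, colSum n k' j := sum_rowSum_eq_sum_colSum k' l
      _ ≤ #(Ico 1 l) • (n + 1) := sum_le_card_nsmul _ _ _ fun j _ => colSum_le k' j
      _ = (l - 1) * (n + 1) := by simp
  have h9 := Nat.le_of_mul_le_mul_right h8 (Nat.succ_pos n)
  omega

theorem eq_zero_of_add_lt_col {k l : ℕ} (h : k + bandBound n < l) : edgarMatrix n k l = 0 :=
  eq_zero_of_ne_one fun h1 => by
    have := col_le_of_eq_one h1
    have := skipBound_le_bandBound (n := n)
    omega

theorem eq_zero_of_add_lt_row {k l : ℕ} (h : l + bandBound n < k) : edgarMatrix n k l = 0 :=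
  eq_zero_of_ne_one fun h1 => by
    have := row_le_of_eq_one h1
    omega

/-! ### Periodicity -/

/-- Agreement of `2C + 1` consecutive rows with their shifts propagates downwards, where `C`
bounds the distance of the ones from the diagonal. -/
theorem shift_eq_of_window {p c : ℕ} (hc : bandBound n < c)
    (h : ∀ i j, c ≤ i → i ≤ c + 2 * bandBound n →
      edgarMatrix n (i + p) (j + p) = edgarMatrix n i j) (i j : ℕ) (hi : c ≤ i) :
    edgarMatrix n (i + p) (j + p) = edgarMatrix n i j := by
  induction i using Nat.strong_induction_on generalizing j with
  | _ i ihi =>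
  induction j using Nat.strong_induction_on with
  | _ j ihj =>
  rcases le_or_gt i (c + 2 * bandBound n) with hic | hic
  · exact h i j hi hic
  rcases lt_or_ge (j + bandBound n) i with hji | hji
  · rw [eq_zero_of_add_lt_row hji, eq_zero_of_add_lt_row (by omega)]
  have hrow : rowSum n (i + p) (j + p) = rowSum n i j := by
    rw [rowSum, add_comm j p, sum_range_add, sum_eq_zero, zero_add]
    · refine sum_congr rfl fun x hx => ?_
      rw [add_comm p x]
      exact ihj x (mem_range.1 hx)
    · intro x hx
      have := mem_range.1 hx
      exact eq_zero_of_add_lt_row (by omega)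
  have hcol' : ∀ x < i, edgarMatrix n (x + p) (j + p) = edgarMatrix n x j := by
    intro x hx
    -- Here `j ≥ i - C > c + C`, so rows before `c` cannot reach column `j`; this is why the window
    -- spans `2C` further rows.
    rcases lt_or_ge x c with hxc | hxc
    · rw [eq_zero_of_add_lt_col (by omega), eq_zero_of_add_lt_col (by omega)]
    · exact ihi x hx j hxc
  have hcol : colSum n (i + p) (j + p) = colSum n i j := by
    rw [colSum, add_comm i p, sum_range_add, sum_eq_zero, zero_add]
    · refine sum_congr rfl fun x hx => ?_
      rw [add_comm p x]
      exact hcol' x (mem_range.1 hx)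
    · intro x hx
      have := mem_range.1 hx
      exact eq_zero_of_add_lt_col (by omega)
  have key : edgarMatrix n (i + p) (j + p) = 1 ↔ edgarMatrix n i j = 1 := by
    rw [eq_one_iff (by omega) (by omega), eq_one_iff (by omega) (by omega), hrow, hcol]
    refine and_congr_right fun _ => and_congr_right fun _ => ?_
    constructor
    · intro H x y hx hy h1 h2 h3
      rcases lt_or_ge x c with hxc | hxc
      · rw [eq_zero_of_add_lt_col (by omega)] at h2
        omega
      · exact H (x + p) (y + p) (by omega) (by omega) ((ihi x hx y hxc).trans h1)
          ((hcol' x hx).trans h2) ((ihj y hy).trans h3)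
    · intro H x y hx hy h1 h2 h3
      rcases lt_or_ge x (c + p) with hxc | hxc
      · rw [eq_zero_of_add_lt_col (by omega)] at h2
        omega
      rcases lt_or_ge y p with hyp | hyp
      · rw [eq_zero_of_add_lt_row (by omega)] at h3
        omega
      obtain ⟨x, rfl⟩ := Nat.exists_eq_add_of_le' (show p ≤ x by omega)
      obtain ⟨y, rfl⟩ := Nat.exists_eq_add_of_le' hyp
      have hx' : x < i := by omega
      have hy' : y < j := by omega
      exact H x y hx' hy' ((ihi x hx' y (by omega)).symm.trans h1)
        ((hcol' x hx').symm.trans h2) ((ihj y hy').symm.trans h3)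
  by_cases h1 : edgarMatrix n i j = 1
  · rw [h1, key.2 h1]
  · rw [eq_zero_of_ne_one h1, eq_zero_of_ne_one (mt key.1 h1)]

theorem periodSet_nonempty (n : ℕ) : (periodSet n).Nonempty := by
  set C := bandBound n with hC
  -- Pigeonhole on windows of the band: `x` is the row, `y - C` the offset from the diagonal. The
  -- start `k + (C + 1)` exceeds `C`, as propagation requires.
  let g : ℕ → Fin (2 * C + 1) → Fin (2 * C + 1) → Bool := fun k x y =>
    decide (edgarMatrix n (k + (C + 1) + x) (k + 1 + x + y) = 1)
  obtain ⟨k₁, k₂, hne, hg⟩ := Finite.exists_ne_map_eq_of_infinite g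
  wlog hlt : k₁ < k₂ generalizing k₁ k₂
  · exact this k₂ k₁ hne.symm hg.symm (by omega)
  refine ⟨k₂ - k₁, by omega, k₁ + C, fun i j hi _ => ?_⟩
  obtain ⟨p, rfl⟩ : ∃ p, k₂ = k₁ + p := ⟨k₂ - k₁, by omega⟩
  rw [Nat.add_sub_cancel_left]
  refine shift_eq_of_window (c := k₁ + (C + 1)) (by omega) (fun i j hi hi' => ?_) i j (by omega)
  rw [← hC] at hi'
  rcases lt_or_ge (j + C) i with hji | hji
  · rw [eq_zero_of_add_lt_row (by omega), eq_zero_of_add_lt_row (by omega)]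
  rcases lt_or_ge (i + C) j with hij | hij
  · rw [eq_zero_of_add_lt_col (by omega), eq_zero_of_add_lt_col (by omega)]
  have := congrFun (congrFun hg ⟨i - (k₁ + (C + 1)), by omega⟩) ⟨j + C - i, by omega⟩
  simp only [g, decide_eq_decide] at this
  rw [show k₁ + (C + 1) + (i - (k₁ + (C + 1))) = i by omega,
    show k₁ + 1 + (i - (k₁ + (C + 1))) + (j + C - i) = j by omega,
    show k₁ + p + (C + 1) + (i - (k₁ + (C + 1))) = i + p by omega,
    show k₁ + p + 1 + (i - (k₁ + (C + 1))) + (j + C - i) = j + p by omega] at this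
  by_cases h1 : edgarMatrix n i j = 1
  · rw [h1, this.1 h1]
  · rw [eq_zero_of_ne_one h1, eq_zero_of_ne_one (mt this.2 h1)]

theorem isLeast_period (n : ℕ) : IsLeast (periodSet n) (period n) :=
  ⟨Nat.sInf_mem (periodSet_nonempty n), fun _ h => Nat.sInf_le h⟩

theorem isLeast_preperiod (n : ℕ) : IsLeast (preperiodSet n) (preperiod n) :=
  ⟨Nat.sInf_mem (isLeast_period n).1.2, fun _ h => Nat.sInf_le h⟩

theorem exists_eq_one {k : ℕ} (hk : 1 ≤ k) : ∃ l, edgarMatrix n k l = 1 := by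
  by_contra! h
  have := rowSum_eq (n := n) hk (Nat.lt_succ_self _)
  rw [rowSum, sum_eq_zero fun j _ => eq_zero_of_ne_one (h j)] at this
  omega

theorem isGreatest_breadth (n : ℕ) : IsGreatest (diagDistSet n) (breadth n) := by
  have hbdd : BddAbove (diagDistSet n) := by
    refine ⟨bandBound n, ?_⟩
    rintro d ⟨i, j, -, -, h, -, rfl⟩
    have := row_le_of_eq_one h
    have := col_le_of_eq_one h
    have := skipBound_le_bandBound (n := n)
    omega
  have hne : (diagDistSet n).Nonempty := by
    obtain ⟨l, hl⟩ := exists_eq_one (n := n) (Nat.succ_pos (preperiod n))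
    exact ⟨_, preperiod n + 1, l, Nat.succ_pos _, pos_right hl, hl, Nat.lt_succ_self _, rfl⟩
  exact ⟨Nat.sSup_mem hne hbdd, fun _ h => le_csSup hbdd h⟩

/-! ### Folding -/

/-- The column of the infinite matrix that is folded onto column `j` in row `i`. -/
def unfoldCol (q v i j : ℕ) : ℕ :=
  if i ≤ j + q / 2 ∧ j ≤ i + q / 2 then v + j
  else if i + q / 2 < j then v + j - q else v + j + q

theorem foldedMatrix_apply (n q v : ℕ) (i j : Icc 1 q) :
    foldedMatrix n q v i j = edgarMatrix n (v + i) (unfoldCol q v i j) := by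
  simp only [foldedMatrix, Matrix.of_apply, unfoldCol]
  split_ifs <;> rfl

/-- The value is congruent to `v + j` modulo `q`, and `1, …, q` are distinct residues; `q ≤ v` keeps
the subtraction exact. -/
theorem unfoldCol_injOn {q v i j j' : ℕ} (hv : q ≤ v)
    (hj : j ∈ Icc 1 q) (hj' : j' ∈ Icc 1 q)
    (h : unfoldCol q v i j = unfoldCol q v i j') : j = j' := by
  rw [mem_Icc] at hj hj'
  unfold unfoldCol at h
  split_ifs at h <;> omega

theorem exists_unfoldCol_eq {q v i l : ℕ} (hi : i ∈ Icc 1 q)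
    (h1 : l < v + i + q / 2) (h2 : v + i < l + q / 2) :
    ∃ j ∈ Icc 1 q, unfoldCol q v i j = l := by
  rw [mem_Icc] at hi
  rcases le_or_gt l v with hl | hl
  · refine ⟨l + q - v, by rw [mem_Icc]; omega, ?_⟩
    unfold unfoldCol
    split_ifs <;> omega
  rcases le_or_gt l (v + q) with hl' | hl'
  · refine ⟨l - v, by rw [mem_Icc]; omega, ?_⟩
    unfold unfoldCol
    split_ifs <;> omega
  · refine ⟨l - v - q, by rw [mem_Icc]; omega, ?_⟩
    unfold unfoldCol
    split_ifs <;> omega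

theorem rowWeight_foldedMatrix {q v : ℕ} (hb : breadth n < q / 2) (hv : preperiod n + q ≤ v)
    (i : Icc 1 q) : rowWeight (foldedMatrix n q v) i = n + 1 := by
  have hi := mem_Icc.1 i.2
  rw [← rowSum_eq (n := n) (k := v + i) (by omega) (Nat.lt_succ_self _), ← card_filter_row,
    rowWeight]
  refine card_bij (fun j _ => unfoldCol q v i j) ?_ ?_ ?_
  · intro j hj
    rw [mem_filter, foldedMatrix_apply] at hj
    have := col_le_of_eq_one hj.2
    exact mem_filter.2 ⟨mem_range.2 (by omega), hj.2⟩
  · intro j _ j' _ h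
    exact Subtype.ext (unfoldCol_injOn (by omega) j.2 j'.2 h)
  · intro l hl
    have hl := (mem_filter.1 hl).2
    -- Row `v + i` lies beyond the preperiod, so `b` bounds the distance of its ones from the
    -- diagonal.
    have hd := (isGreatest_breadth n).2
      ⟨v + i, l, by omega, pos_right hl, hl, by omega, rfl⟩
    obtain ⟨j, hj, hjl⟩ := exists_unfoldCol_eq (v := v) (l := l) i.2 (by omega) (by omega)
    refine ⟨⟨j, hj⟩, ?_, hjl⟩
    rw [mem_filter, foldedMatrix_apply]
    exact ⟨mem_univ _, by simpa only [hjl] using hl⟩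

end EdgarMatrix

theorem theorem4p1 (n : ℕ) (hn : 1 ≤ n) :
    IsLeast (periodSet n) (period n) ∧
    IsLeast (preperiodSet n) (preperiod n) ∧
    IsGreatest (diagDistSet n) (breadth n) ∧
    ∀ m v : ℕ, 1 ≤ m → breadth n < period n * m / 2 →
      preperiod n + period n * m ≤ v →
      ∀ i : Finset.Icc 1 (period n * m),
        rowWeight (foldedMatrix n (period n * m) v) i = n + 1 :=
  ⟨EdgarMatrix.isLeast_period n, EdgarMatrix.isLeast_preperiod n,
    EdgarMatrix.isGreatest_breadth n,
    fun _ _ _ hb hv i => EdgarMatrix.rowWeight_foldedMatrix hb hv i⟩
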